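/- Let $F$ be a differential field of characteristic zero with derivation $D_F$ and algebraically closed field of constants $C$. A (pro)algebraic group $G$ over $C$ means an affine group scheme over $C$ (not necessarily of finite type), with coordinate Hopf algebra $C[G]$; put $F[G]=F\otimes_C C[G]$, let $F(G)$ be its fraction field when $F[G]$ is a domain, and let $G$ act on $F[G]$ by right translation, $(h\cdot f)(g)=f(gh)$. Let $\overline{G}$ be a (pro)algebraic group over $C$ such that $F[\overline{G}]$ is a unique factorization domain, and let $D$ be a derivation of $F[\overline{G}]$ which extends $D_F$, commutes with the action of $\overline{G}$, and satisfies: 1. $F(\overline{G})$, with the unique derivation extending $D$, has no new constants, i.e. its field of constants is $C$; 2. if $0\neq q\in F[\overline{G}]$ and $q\mid D(q)$, then $q$ is a unit. Let $1\to\mathbb{G}_a\to G\to\overline{G}\to 1$ be a central extension of (pro)algebraic groups over $C$ which splits as varieties (that is, $G\to\overline{G}$ has a section that is a morphism of (pro)varieties over $C$) but does not split as algebraic groups over $F$ (that is, $G_F\to\overline{G}_F$ has no section that is a homomorphism of group schemes over $F$). Then $F[G]$ is a unique factorization domain, and there is a derivation $D'$ of $F[G]$ which extends $D$ (via $F[\overline{G}]\subseteq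 F[G]$), commutes with the action of $G$, and is such that $F(G)$, with the derivation extending $D'$, has no new constants (its field of constants is $C$), and every $0\neq q\in F[G]$ with $q\mid D'(q)$ is a unit. -/

import Mathlib

open scoped TensorProduct

noncomputable section

namespace PicardVessiot

/-! Throughout, an affine (pro)algebraic group `G` over a field `C` is given by its coordinate ring
`C[G]`, an arbitrary commutative Hopf algebra over `C` (finitely generated exactly when `G` is
algebraic).  Then `F[G] = F ⊗[C] C[G]`. -/

section FractionField

variable {C R : Type*} [CommRing C] [CommRing R] [Algebra C R]

/-- The ring homomorphism `r ↦ r + D(r) ε` from `R` to the dual numbers over `Frac R`. -/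
def dualHom (D : Derivation C R R) : R →ₐ[C] DualNumber (FractionRing R) where
  toFun r := TrivSqZeroExt.inl (algebraMap R (FractionRing R) r) +
    TrivSqZeroExt.inr (algebraMap R (FractionRing R) (D r))
  map_one' := by ext <;> simp
  map_zero' := by ext <;> simp
  map_add' x y := by
    ext <;> simp only [map_add, TrivSqZeroExt.fst_add, TrivSqZeroExt.snd_add,
      TrivSqZeroExt.fst_inl, TrivSqZeroExt.snd_inl, TrivSqZeroExt.fst_inr, TrivSqZeroExt.snd_inr]
    all_goals ring
  map_mul' x y := by
    ext <;> simp [Algebra.smul_def, TrivSqZeroExt.algebraMap_eq_inl', mul_comm]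
  commutes' c := by
    ext
    · simp [TrivSqZeroExt.algebraMap_eq_inl', ← IsScalarTower.algebraMap_apply]
    · simp [TrivSqZeroExt.algebraMap_eq_inl']

theorem isUnit_dualHom (D : Derivation C R R) (s : nonZeroDivisors R) :
    IsUnit (dualHom D (s : R)) := by
  rw [TrivSqZeroExt.isUnit_iff_isUnit_fst]
  simpa [dualHom] using IsLocalization.map_units (FractionRing R) s

/-- The extension of `r ↦ r + D(r) ε` to the total ring of fractions. -/
def dualLift (D : Derivation C R R) : FractionRing R →ₐ[C] DualNumber (FractionRing R) :=
  IsLocalization.liftAlgHom (M := nonZeroDivisors R) (f := dualHom D) (isUnit_dualHom D)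

theorem dualLift_algebraMap (D : Derivation C R R) (r : R) :
    dualLift D (algebraMap R (FractionRing R) r) = dualHom D r := by
  simp [dualLift]

theorem fst_dualLift (D : Derivation C R R) (x : FractionRing R) :
    (dualLift D x).fst = x := by
  have h : ((TrivSqZeroExt.fstHom C (FractionRing R) (FractionRing R)).comp
      (dualLift D)).toRingHom = RingHom.id (FractionRing R) := by
    apply IsLocalization.ringHom_ext (nonZeroDivisors R)
    ext r
    simp [dualLift_algebraMap, dualHom]
  exact congrArg (fun f : FractionRing R →+* FractionRing R => f x) h

/-- The derivation of the fraction field of `R` that extends a derivation `D` of `R`. -/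
def fractionDerivation (D : Derivation C R R) :
    Derivation C (FractionRing R) (FractionRing R) :=
  Derivation.mk'
    { toFun := fun x => (dualLift D x).snd
      map_add' := fun x y => by simp
      map_smul' := fun c x => by simp }
    (fun x y => by simp [fst_dualLift, mul_comm])

/-- `fractionDerivation D` extends `D`; this determines it. -/
theorem fractionDerivation_algebraMap (D : Derivation C R R) (r : R) :
    fractionDerivation D (algebraMap R (FractionRing R) r) =
      algebraMap R (FractionRing R) (D r) := by
  simp [fractionDerivation, dualLift_algebraMap, dualHom, Algebra.smul_def,
    TrivSqZeroExt.algebraMap_eq_inl']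

/-- The fraction field of `R`, with the derivation extending `D`, has no constants outside `C`. -/
def NoNewConstants (D : Derivation C R R) : Prop :=
  ∀ x : FractionRing R, fractionDerivation D x = 0 →
    x ∈ (algebraMap C (FractionRing R)).range

/-- A nonzero element of `R` that divides its derivative is a unit. -/
def DvdDerivImpliesUnit (D : Derivation C R R) : Prop :=
  ∀ q : R, q ≠ 0 → q ∣ D q → IsUnit q

end FractionField

section Groups

variable {C F A B : Type*} [Field C] [Field F] [Algebra C F]
  [CommRing A] [HopfAlgebra C A] [CommRing B] [HopfAlgebra C B]

/-- The derivation `D` of `F[G] = F ⊗[C] A` extends the derivation `DF` of `F`. -/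
def ExtendsBase (DF : Derivation C F F) (D : Derivation C (F ⊗[C] A) (F ⊗[C] A)) : Prop :=
  ∀ a : F, D (a ⊗ₜ[C] (1 : A)) = DF a ⊗ₜ[C] (1 : A)

variable (C F A) in
/-- The action of `G` on `F[G]` by right translation, `(h · f)(g) = f(gh)`, as the coaction
`F[G] → F[G] ⊗[C] C[G]` sending `f` to the function `(g, h) ↦ f(gh)`: it maps `a ⊗ f` to
`∑ (a ⊗ f₁) ⊗ f₂`, where `∑ f₁ ⊗ f₂` is the comultiplication of `f`. -/
def translation : F ⊗[C] A →ₗ[C] (F ⊗[C] A) ⊗[C] A :=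
  (TensorProduct.assoc C F A A).symm.toLinearMap ∘ₗ
    (Coalgebra.comul (R := C) (A := A)).lTensor F

/-- The derivation `D` of `F[G]` commutes with the action of `G`: as functions of `(g, h)`,
`D(h · f) = h · D(f)`, where `D` acts on functions of `g`. -/
def IsEquivariant (D : Derivation C (F ⊗[C] A) (F ⊗[C] A)) : Prop :=
  ∀ f : F ⊗[C] A,
    translation C F A (D f) = (D : F ⊗[C] A →ₗ[C] F ⊗[C] A).rTensor A (translation C F A f)

variable (C) in
/-- The coordinate ring `C[y]` of the additive group over `C`, with `y` primitive:
the symmetric algebra of a one-dimensional space. -/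
abbrev AdditiveGroupRing : Type _ := SymmetricAlgebra C C

/-- `1 → 𝔾ₐ → G → Ḡ → 1` is a central extension, where `A = C[G]`, `B = C[Ḡ]`,
`p : C[Ḡ] → C[G]` is dual to `G → Ḡ` and `i : C[G] → C[y]` is dual to `𝔾ₐ → G`. -/
structure IsCentralExtension (p : B →ₐc[C] A) (i : A →ₐc[C] AdditiveGroupRing C) : Prop where
  /-- `G → Ḡ` is surjective. -/
  injective : Function.Injective p
  /-- `𝔾ₐ → G` is a closed embedding. -/
  surjective : Function.Surjective i
  /-- The image of `𝔾ₐ` is the kernel of `G → Ḡ`, that is, the fibre over the identity. -/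
  exact : RingHom.ker i =
    (RingHom.ker (Bialgebra.counitAlgHom C B)).map (p : B →ₐ[C] A)
  /-- The two maps `(z, g) ↦ z g` and `(z, g) ↦ g z` from `𝔾ₐ × G` to `G` agree. -/
  central : ∀ a : A,
    (i : A →ₗ[C] AdditiveGroupRing C).rTensor A (Coalgebra.comul (R := C) a) =
      (i : A →ₗ[C] AdditiveGroupRing C).rTensor A
        (TensorProduct.comm C A A (Coalgebra.comul (R := C) a))

/-- `G → Ḡ` has a section that is a morphism of (pro)varieties over `C`. -/
def SplitsAsVarieties (p : B →ₐc[C] A) : Prop :=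
  ∃ s : A →ₐ[C] B, ∀ b : B, s (p b) = b

variable (F) in
/-- `G → Ḡ` has, after base change to `F`, a section that is a homomorphism of groups over `F`. -/
def SplitsAsGroupsOver (p : B →ₐc[C] A) : Prop :=
  ∃ s : F ⊗[C] A →ₐc[F] F ⊗[C] B,
    ∀ x : F ⊗[C] B, s (Bialgebra.TensorProduct.map (BialgHom.id F F) p x) = x

/-- The derivation `D'` of `F[G]` extends the derivation `D` of `F[Ḡ]`. -/
def ExtendsAlong (p : B →ₐc[C] A) (D : Derivation C (F ⊗[C] B) (F ⊗[C] B))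
    (D' : Derivation C (F ⊗[C] A) (F ⊗[C] A)) : Prop :=
  ∀ x : F ⊗[C] B, D' (Bialgebra.TensorProduct.map (BialgHom.id F F) p x) =
    Bialgebra.TensorProduct.map (BialgHom.id F F) p (D x)

end Groups

end PicardVessiot

end

/-!
Write `R = F[Ḡ]`. Since the extension is split as varieties, `F[G]` is a polynomial ring `R[Y]`,
where `Y(g)` is the element `g σ(ḡ)⁻¹` of `𝔾ₐ`, for `σ` the section. As `𝔾ₐ` is central,
`Y(gh) = Y(g) + Y(h) + f(ḡ, h̄)` for a function `f` on `Ḡ × Ḡ`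
(`IsCentralExtension.exists_coordinate`). This is obtained by computing in the monoids of `T`-points
`Hom(C[G], T)` under convolution. In particular `F[G]` is a unique factorization domain.

An equivariant derivation of `F[G]` extending the one of `F` is the same as a tangent vector of `G`
at the identity with values in `F` (`invariantDerivation`, `IsEquivariant.apply_tmul`). The tangent
vector of `D` is lifted to `G` along a section that preserves the identity, and this gives `D'`. By
the formula for `Y(gh)`, the derivative `r = D'(Y)` lies in `R`.

The point is that `r` is not a derivative in `R` (`exists_bialgHom_section_of_constant`). If
`r = D(x)`, then `w = Y - x` is a constant. Translation by `h ∈ G` changes `w` by an element of `R`,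
which is again constant, so lies in `C`. So `w(gh) = w(g) + χ(h)` for a homomorphism `χ : G → 𝔾ₐ`,
and `χ` differs from `Y` by a function on `Ḡ`. The kernel of `χ` then splits the extension, over `C`
and a fortiori over `F`.

The rest is algebra in `R[Y]`. If `q = aₙ Yⁿ + ⋯` is constant then `aₙ ∈ C`, and if `n > 0` the
coefficient of `Yⁿ⁻¹` exhibits `r` as a derivative; so the constants of `R[Y]` are those of `R`. If
`q ∣ D'(q)` then the quotient has degree zero, so `aₙ ∣ D(aₙ)`, hence `aₙ` is a unit, and `q / aₙ` is
constant (`dvdDerivImpliesUnit_polynomial`). Finally, a constant fraction in lowest terms has a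
denominator which divides its derivative and is therefore a unit
(`noNewConstants_of_forall_mem_range`).
-/

noncomputable section

namespace PicardVessiot

/-! ### Derivations of polynomial rings -/

section UniqueFactorization

variable {C R : Type*} [CommRing C] [CommRing R] [Algebra C R]

theorem NoNewConstants.mem_range {D : Derivation C R R} (h : NoNewConstants D) {x : R}
    (hx : D x = 0) : x ∈ (algebraMap C R).range := by
  obtain ⟨c, hc⟩ := h (algebraMap R (FractionRing R) x)
    (by rw [fractionDerivation_algebraMap, hx, map_zero])
  refine ⟨c, IsFractionRing.injective R (FractionRing R) ?_⟩
  rw [← hc, ← IsScalarTower.algebraMap_apply]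

/-- Since a nonunit never divides its derivative, a fraction in lowest terms can only be constant
if its denominator is a unit. -/
theorem noNewConstants_of_forall_mem_range [IsDomain R] [UniqueFactorizationMonoid R]
    {D : Derivation C R R} (hunit : DvdDerivImpliesUnit D)
    (h : ∀ x : R, D x = 0 → x ∈ (algebraMap C R).range) :
    NoNewConstants D := by
  intro z hz
  obtain ⟨u, v, huv, hz'⟩ := IsFractionRing.exists_reduced_fraction R z
  have hv0 : (v : R) ≠ 0 := nonZeroDivisors.ne_zero v.2
  have hzv : z * algebraMap R (FractionRing R) v = algebraMap R (FractionRing R) u := by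
    rw [← hz', IsLocalization.mk'_spec]
  have key : u * D v = v * D u := by
    apply IsFractionRing.injective R (FractionRing R)
    have h1 := congrArg (fractionDerivation D) hzv
    rw [Derivation.leibniz, hz, fractionDerivation_algebraMap, fractionDerivation_algebraMap,
      smul_zero, add_zero, smul_eq_mul] at h1
    rw [map_mul, map_mul, ← h1, ← hzv]
    ring
  have hdvd : (v : R) ∣ D v :=
    huv.symm.dvd_of_dvd_mul_left ⟨D u, key⟩
  obtain ⟨w, hw⟩ := (hunit v hv0 hdvd).exists_right_inv
  have hx : z = algebraMap R (FractionRing R) (u * w) := by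
    rw [map_mul, ← hzv, mul_assoc, ← map_mul, hw, map_one, mul_one]
  have hDx : D (u * w) = 0 := by
    apply IsFractionRing.injective R (FractionRing R)
    rw [← fractionDerivation_algebraMap, ← hx, hz, map_zero]
  obtain ⟨c, hc⟩ := h _ hDx
  exact ⟨c, by rw [hx, ← hc, ← IsScalarTower.algebraMap_apply]⟩

end UniqueFactorization

section Polynomial

open Polynomial

variable {k R : Type*} [Field k] [CommRing R] [Algebra k R]
  {D : Derivation k R R} {E : Derivation k R[X] R[X]} {r : R}

/-- A derivation of `R[X]` extending `D` acts by `D` on the coefficients, plus `E X` times the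
formal derivative. -/
theorem coeff_derivation_polynomial (hC : ∀ a, E (C a) = C (D a)) (hX : E X = C r) (q : R[X])
    (n : ℕ) : (E q).coeff n = D (q.coeff n) + r * (((n : R) + 1) * q.coeff (n + 1)) := by
  induction q using Polynomial.induction_on' with
  | add p q hp hq => simp only [map_add, coeff_add, hp, hq]; ring
  | monomial m a =>
    have h : E (monomial m a) = monomial m (D a) + C r * derivative (monomial m a) := by
      rw [derivative_monomial, ← C_mul_X_pow_eq_monomial, ← C_mul_X_pow_eq_monomial,
        ← C_mul_X_pow_eq_monomial, Derivation.leibniz, Derivation.leibniz_pow, hC, hX]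
      simp only [smul_eq_mul, nsmul_eq_mul, map_mul, map_natCast]
      ring
    rw [h, coeff_add, coeff_C_mul, coeff_derivative, coeff_monomial, coeff_monomial, coeff_monomial]
    split_ifs <;> simp <;> ring

/-- The leading coefficient of a constant polynomial of degree `n + 1` is a constant, and the
coefficient below it then exhibits `r` as a derivative. -/
theorem mem_range_of_derivation_polynomial_eq_zero [CharZero k]
    (hC : ∀ a, E (C a) = C (D a)) (hX : E X = C r)
    (hconst : ∀ x : R, D x = 0 → x ∈ (algebraMap k R).range) (hr : ∀ x : R, D x ≠ r)
    {q : R[X]} (hq : E q = 0) : q ∈ (algebraMap k R[X]).range := by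
  have hcoeff (n : ℕ) : D (q.coeff n) + r * (((n : R) + 1) * q.coeff (n + 1)) = 0 := by
    rw [← coeff_derivation_polynomial hC hX, hq, coeff_zero]
  have hlead : D q.leadingCoeff = 0 := by
    simpa [coeff_eq_zero_of_natDegree_lt (Nat.lt_succ_self q.natDegree)] using hcoeff q.natDegree
  obtain ⟨c, hc⟩ := hconst _ hlead
  obtain h0 | ⟨n, hn⟩ : q.natDegree = 0 ∨ ∃ n, q.natDegree = n + 1 := by
    cases q.natDegree <;> simp
  · refine ⟨c, ?_⟩
    rw [eq_C_of_natDegree_eq_zero h0, ← h0, ← leadingCoeff, ← hc]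
    rfl
  · exfalso
    have hc0 : c ≠ 0 := by
      rintro rfl
      rw [map_zero] at hc
      rw [leadingCoeff_eq_zero.1 hc.symm] at hn
      simp at hn
    have h1 := hcoeff n
    rw [← hn, ← leadingCoeff, ← hc] at h1
    have hd : ((n : k) + 1) * c ≠ 0 := mul_ne_zero (Nat.cast_add_one_ne_zero n) hc0
    apply hr (-(((n : k) + 1) * c)⁻¹ • q.coeff n)
    have h2 : ((n : R) + 1) * algebraMap k R c = algebraMap k R (((n : k) + 1) * c) := by simp
    rw [h2] at h1
    rw [Derivation.map_smul, eq_neg_of_add_eq_zero_left h1, smul_neg, neg_smul, neg_neg,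
      Algebra.smul_def, mul_left_comm, ← map_mul, inv_mul_cancel₀ hd, map_one, mul_one]

/-- If `q` divides `E q` then, for degree reasons, the quotient lies in `R`; hence the leading
coefficient of `q` divides its derivative and is a unit, and dividing by it gives a constant. -/
theorem dvdDerivImpliesUnit_polynomial [IsDomain R] [CharZero k]
    (hC : ∀ a, E (C a) = C (D a)) (hX : E X = C r)
    (hunit : DvdDerivImpliesUnit D)
    (hconst : ∀ x : R, D x = 0 → x ∈ (algebraMap k R).range) (hr : ∀ x : R, D x ≠ r) :
    DvdDerivImpliesUnit E := by
  rintro q hq0 ⟨c, hc⟩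
  have hlt {n : ℕ} (hn : q.natDegree < n) : q.coeff n = 0 := coeff_eq_zero_of_natDegree_lt hn
  have hdeg : (E q).natDegree ≤ q.natDegree := by
    refine natDegree_le_iff_coeff_eq_zero.2 fun n hn => ?_
    rw [coeff_derivation_polynomial hC hX, hlt hn, hlt (by omega)]
    simp
  have hc0 : c.natDegree = 0 := by
    by_cases h : c = 0
    · simp [h]
    · rw [hc, natDegree_mul hq0 h] at hdeg
      omega
  obtain ⟨d, rfl⟩ := natDegree_eq_zero.1 hc0
  -- Compare the coefficients of top degree in `E q = q d`.
  have hlead : D q.leadingCoeff = q.leadingCoeff * d := by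
    have h := coeff_derivation_polynomial hC hX q q.natDegree
    rw [hc, coeff_mul_C, hlt (Nat.lt_succ_self _)] at h
    simpa using h.symm
  have hu := hunit _ (leadingCoeff_ne_zero.2 hq0) ⟨d, hlead⟩
  obtain ⟨w, hw⟩ := hu.exists_right_inv
  have hqm : C q.leadingCoeff * (C w * q) = q := by
    rw [← mul_assoc, ← C_mul, hw, C_1, one_mul]
  have hEm : E (C w * q) = 0 := by
    have h := congrArg E hqm
    rw [Derivation.leibniz, hC, hlead, hc, smul_eq_mul, smul_eq_mul] at h
    have h0 : C q.leadingCoeff * E (C w * q) = 0 := by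
      have h3 : C w * q * C (q.leadingCoeff * d) = q * C d := by
        rw [C_mul, ← mul_assoc, mul_comm (C w * q), hqm]
      rwa [h3, add_eq_right] at h
    exact (mul_eq_zero.1 h0).resolve_left (by simpa using hq0)
  obtain ⟨e, he⟩ := mem_range_of_derivation_polynomial_eq_zero hC hX hconst hr hEm
  have he0 : e ≠ 0 := by
    rintro rfl
    rw [← hqm, ← he] at hq0
    simp at hq0
  rw [← hqm, ← he]
  exact (hu.map C).mul ((IsUnit.mk0 e he0).map _)

end Polynomial

section Transport

variable {C R S : Type*} [CommRing C] [CommRing R] [Algebra C R] [CommRing S] [Algebra C S]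

/-- The derivation of `R` corresponding to a derivation of the isomorphic algebra `S`. -/
def transportDerivation (e : R ≃ₐ[C] S) (D : Derivation C S S) : Derivation C R R :=
  Derivation.mk' (e.symm.toLinearMap ∘ₗ (D : S →ₗ[C] S) ∘ₗ e.toLinearMap) fun a b => by
    simp [Derivation.leibniz]

theorem transportDerivation_apply (e : R ≃ₐ[C] S) (D : Derivation C S S) (x : R) :
    transportDerivation e D x = e.symm (D (e x)) := rfl

theorem DvdDerivImpliesUnit.of_transportDerivation {e : R ≃ₐ[C] S} {D : Derivation C S S}
    (h : DvdDerivImpliesUnit (transportDerivation e D)) : DvdDerivImpliesUnit D := by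
  rintro q hq0 ⟨c, hc⟩
  have := h (e.symm q) (by simpa using hq0)
    ⟨e.symm c, by rw [transportDerivation_apply, e.apply_symm_apply, hc, map_mul]⟩
  simpa using this.map e

end Transport

/-! ### Groups of points, and the coordinate of a central extension by the additive group -/

open WithConv Coalgebra

section Points

variable {C A B T T' : Type*} [Field C] [CommRing A] [Bialgebra C A] [CommRing B] [Bialgebra C B]
  [CommRing T] [Algebra C T] [CommRing T'] [Algebra C T']

variable (A) in
/-- The map `G(T) → G(T')` on points induced by `T → T'`, where `A = C[G]`. Points are algebra maps
out of `A`, and the monoid law on them is convolution. -/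
def pointsMap (h : T →ₐ[C] T') : WithConv (A →ₐ[C] T) →* WithConv (A →ₐ[C] T') where
  toFun g := toConv (h.comp g.ofConv)
  map_one' := by
    apply WithConv.ofConv_injective
    ext a
    exact h.commutes _
  map_mul' f g := WithConv.ofConv_injective (AlgHom.comp_convMul_distrib h f g)

variable (T) in
/-- The map `G(T) → H(T)` on points induced by `p : C[H] → C[G]`. -/
def pointsPull (p : B →ₐc[C] A) : WithConv (A →ₐ[C] T) →* WithConv (B →ₐ[C] T) where
  toFun g := toConv (g.ofConv.comp (p : B →ₐ[C] A))
  map_one' := by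
    apply WithConv.ofConv_injective
    ext a
    change algebraMap C T (counit (R := C) (p a)) = algebraMap C T (counit (R := C) a)
    rw [CoalgHomClass.counit_comp_apply]
  map_mul' f g := WithConv.ofConv_injective (AlgHom.convMul_comp_bialgHom_distrib f g p)

/-- The map `H(T) → G(T)` of sets of points induced by an algebra map `s : C[G] → C[H]`, which
need not respect the comultiplications. -/
def pointsSection (s : A →ₐ[C] B) (x : WithConv (B →ₐ[C] T)) : WithConv (A →ₐ[C] T) :=
  toConv (x.ofConv.comp s)

theorem pointsPull_pointsSection {p : B →ₐc[C] A} {s : A →ₐ[C] B} (hs : ∀ b, s (p b) = b)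
    (x : WithConv (B →ₐ[C] T)) : pointsPull T p (pointsSection s x) = x := by
  apply WithConv.ofConv_injective
  ext b
  exact congrArg x.ofConv (hs b)

/-- The comultiplication, as a point of `G × G`, is the product of the two projections. -/
theorem toConv_comulAlgHom :
    toConv (Bialgebra.comulAlgHom C A) =
      toConv (Algebra.TensorProduct.includeLeft : A →ₐ[C] A ⊗[C] A) *
        toConv (Algebra.TensorProduct.includeRight : A →ₐ[C] A ⊗[C] A) := by
  apply WithConv.ofConv_injective
  ext a
  refine Eq.trans ?_ (AlgHom.convMul_apply _ _ a).symm
  have : Algebra.TensorProduct.lift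
      (Algebra.TensorProduct.includeLeft : A →ₐ[C] A ⊗[C] A)
      (Algebra.TensorProduct.includeRight : A →ₐ[C] A ⊗[C] A) (fun _ _ => .all ..) =
        AlgHom.id C _ := by ext <;> simp
  exact (DFunLike.congr_fun this (comul (R := C) a)).symm

/-- Addition of points of `𝔾ₐ`, in terms of the coordinate `y`. -/
theorem convMul_ι_one (z w : WithConv (AdditiveGroupRing C →ₐ[C] T)) :
    (z * w).ofConv (SymmetricAlgebra.ι C C 1) =
      z.ofConv (SymmetricAlgebra.ι C C 1) + w.ofConv (SymmetricAlgebra.ι C C 1) := by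
  refine (AlgHom.convMul_apply z w _).trans ?_
  rw [SymmetricAlgebra.comul_ι]
  simp

end Points

section Inverse

variable {C A B T : Type*} [Field C] [CommRing A] [HopfAlgebra C A] [CommRing B] [HopfAlgebra C B]
  [CommRing T] [Algebra C T]

/-- The inverse of a point of `G`. (Mathlib has it as a group inverse when `T` is a bialgebra.) -/
def pointsInv (g : WithConv (A →ₐ[C] T)) : WithConv (A →ₐ[C] T) :=
  toConv (g.ofConv.comp (HopfAlgebra.antipodeAlgHom C A))

theorem mul_pointsInv (g : WithConv (A →ₐ[C] T)) : g * pointsInv g = 1 := by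
  have h : toConv (AlgHom.id C A) * toConv (HopfAlgebra.antipodeAlgHom C A) = 1 :=
    mul_inv_cancel (toConv (AlgHom.id C A))
  have h' := congrArg (pointsMap A g.ofConv) h
  rwa [map_mul, map_one] at h'

theorem pointsInv_mul (g : WithConv (A →ₐ[C] T)) : pointsInv g * g = 1 := by
  have h := congrArg (pointsMap A g.ofConv) (AlgHom.antipode_id_cancel (R := C) (A := A))
  rwa [map_mul, map_one] at h

/-- A section of `G → Ḡ` can be normalized to send the identity to the identity: replace `σ` by
`x ↦ σ(x) σ(1)⁻¹`. -/
theorem exists_counit_section {p : B →ₐc[C] A} {s : A →ₐ[C] B} (hs : ∀ b, s (p b) = b) :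
    ∃ s' : A →ₐ[C] B, (∀ b, s' (p b) = b) ∧ ∀ a, counit (R := C) (s' a) = counit (R := C) a := by
  set σ : WithConv (A →ₐ[C] B) := toConv s with hσ
  set η : C →ₐ[C] B := Algebra.ofId C B
  set ε : B →ₐ[C] C := Bialgebra.counitAlgHom C B
  set σ₁ : WithConv (A →ₐ[C] B) := pointsMap A (η.comp ε) σ with hσ₁
  have hpull : pointsPull B p σ = toConv (AlgHom.id C B) := by
    apply WithConv.ofConv_injective
    ext b
    exact hs b
  have hpull₁ : pointsPull B p σ₁ = 1 :=
    congrArg (pointsMap B (η.comp ε)) hpull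
  have hεη : ε.comp (η.comp ε) = ε := by ext b; simp [ε, η, Algebra.ofId_apply]
  refine ⟨(σ * pointsInv σ₁).ofConv, fun b => ?_, fun a => ?_⟩
  · have h : pointsPull B p (σ * pointsInv σ₁) = toConv (AlgHom.id C B) := by
      rw [map_mul, hpull, ← one_mul (pointsPull B p (pointsInv σ₁)), ← hpull₁, ← map_mul,
        mul_pointsInv, map_one, mul_one]
    exact congrArg (fun g : WithConv (B →ₐ[C] B) => g.ofConv b) h
  · have h : pointsMap A ε (σ * pointsInv σ₁) = 1 := by
      have h' : pointsMap A ε σ₁ = pointsMap A ε σ := by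
        change pointsMap A (ε.comp (η.comp ε)) σ = _
        rw [hεη]
      rw [map_mul, ← h', ← map_mul, mul_pointsInv, map_one]
    exact congrArg (fun g : WithConv (A →ₐ[C] C) => g.ofConv a) h

end Inverse

section CentralExtension

variable {C A B T : Type*} [Field C] [CommRing A] [HopfAlgebra C A] [CommRing B]
  [HopfAlgebra C B] [CommRing T] [Algebra C T]
  {p : B →ₐc[C] A} {i : A →ₐc[C] AdditiveGroupRing C}

theorem IsCentralExtension.apply_apply (hext : IsCentralExtension p i) (b : B) :
    i (p b) = algebraMap C _ (counit (R := C) b) := by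
  have h : p (b - algebraMap C B (counit (R := C) b)) ∈ RingHom.ker i := by
    rw [hext.exact]
    apply Ideal.mem_map_of_mem (p : B →ₐ[C] A)
    simp [RingHom.mem_ker]
  rw [RingHom.mem_ker, map_sub, map_sub, sub_eq_zero] at h
  rw [h]
  exact (AlgHomClass.commutes ((i : A →ₐ[C] AdditiveGroupRing C).comp (p : B →ₐ[C] A)) _)

/-- `𝔾ₐ(T) → G(T) → Ḡ(T)` is trivial. -/
theorem IsCentralExtension.pointsPull_pointsPull (hext : IsCentralExtension p i)
    (z : WithConv (AdditiveGroupRing C →ₐ[C] T)) :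
    pointsPull T p (pointsPull T i z) = 1 := by
  apply WithConv.ofConv_injective
  ext b
  change z.ofConv (i (p b)) = algebraMap C T (counit (R := C) b)
  rw [hext.apply_apply, AlgHom.commutes]

/-- `𝔾ₐ(T)` is central in `G(T)`. -/
theorem IsCentralExtension.pointsPull_mul_comm (hext : IsCentralExtension p i)
    (z : WithConv (AdditiveGroupRing C →ₐ[C] T)) (g : WithConv (A →ₐ[C] T)) :
    pointsPull T i z * g = g * pointsPull T i z := by
  apply WithConv.ofConv_injective
  ext a
  refine (AlgHom.convMul_apply _ _ a).trans (Eq.trans ?_ (AlgHom.convMul_apply _ _ a).symm)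
  have h := congrArg (Algebra.TensorProduct.lift z.ofConv g.ofConv fun _ _ => .all ..)
    (hext.central a)
  have h1 (t : A ⊗[C] A) : Algebra.TensorProduct.lift z.ofConv g.ofConv (fun _ _ => .all ..)
      ((i : A →ₗ[C] AdditiveGroupRing C).rTensor A t) =
      Algebra.TensorProduct.lift (pointsPull T i z).ofConv g.ofConv (fun _ _ => .all ..) t := by
    induction t with
    | zero => simp only [map_zero]
    | add x y hx hy => simp only [map_add, hx, hy]
    | tmul x y => rfl
  have h2 (t : A ⊗[C] A) : Algebra.TensorProduct.lift z.ofConv g.ofConv (fun _ _ => .all ..)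
      ((i : A →ₗ[C] AdditiveGroupRing C).rTensor A (TensorProduct.comm C A A t)) =
      Algebra.TensorProduct.lift g.ofConv (pointsPull T i z).ofConv (fun _ _ => .all ..) t := by
    induction t with
    | zero => simp only [map_zero]
    | add x y hx hy => simp only [map_add, hx, hy]
    | tmul x y => exact mul_comm _ _
  rwa [h1, h2] at h

/-- The map `g ↦ g σ(ḡ)⁻¹` takes values in the kernel `𝔾ₐ`: it is given by an algebra map
`t : C[y] → C[G]`. -/
theorem IsCentralExtension.exists_retraction (hext : IsCentralExtension p i) {s : A →ₐ[C] B}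
    (hs : ∀ b, s (p b) = b) :
    ∃ t : AdditiveGroupRing C →ₐ[C] A,
      pointsPull A i (toConv t) * pointsSection s (toConv (p : B →ₐ[C] A)) =
        toConv (AlgHom.id C A) := by
  set σ : WithConv (A →ₐ[C] A) := pointsSection s (toConv (p : B →ₐ[C] A))
  set τ : WithConv (A →ₐ[C] A) := toConv (AlgHom.id C A) * pointsInv σ with hτ
  have hpτ : pointsPull A p τ = 1 := by
    have h : pointsPull A p (toConv (AlgHom.id C A)) = pointsPull A p σ :=
      (pointsPull_pointsSection hs _).symm
    rw [hτ, map_mul, h, ← map_mul, mul_pointsInv, map_one]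
  have hker : RingHom.ker (i : A →ₐ[C] AdditiveGroupRing C) ≤ RingHom.ker τ.ofConv := by
    change RingHom.ker i ≤ _
    rw [hext.exact, Ideal.map_le_iff_le_comap]
    intro b hb
    have h := congrArg (fun g : WithConv (B →ₐ[C] A) => g.ofConv b) hpτ
    change τ.ofConv (p b) = algebraMap C A (counit (R := C) b) at h
    rw [RingHom.mem_ker, Bialgebra.counitAlgHom_apply] at hb
    rw [hb, map_zero] at h
    exact h
  refine ⟨AlgHom.liftOfSurjective (i : A →ₐ[C] AdditiveGroupRing C) hext.surjective τ.ofConv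
    hker, ?_⟩
  have h : pointsPull A i (toConv (AlgHom.liftOfSurjective (i : A →ₐ[C] AdditiveGroupRing C)
      hext.surjective τ.ofConv hker)) = τ :=
    WithConv.ofConv_injective (AlgHom.liftOfSurjective_comp _ _ _ _)
  rw [h, hτ, mul_assoc, pointsInv_mul, mul_one]

/-- Every point of `G` is the product of a point of `𝔾ₐ` and a value of the section. -/
theorem pointsPull_mul_pointsSection {s : A →ₐ[C] B} {t : AdditiveGroupRing C →ₐ[C] A}
    (ht : pointsPull A i (toConv t) * pointsSection s (toConv (p : B →ₐ[C] A)) =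
        toConv (AlgHom.id C A)) (g : WithConv (A →ₐ[C] T)) :
    pointsPull T i (toConv (g.ofConv.comp t)) * pointsSection s (pointsPull T p g) = g := by
  have h := congrArg (pointsMap A g.ofConv) ht
  rwa [map_mul] at h

/-- The decomposition of a point of `G` as a product of a point of `𝔾ₐ` and a value of the section
is unique. -/
theorem IsCentralExtension.comp_eq_of_mul_eq (hext : IsCentralExtension p i) {s : A →ₐ[C] B}
    (hs : ∀ b, s (p b) = b) {t : AdditiveGroupRing C →ₐ[C] A}
    (ht : pointsPull A i (toConv t) * pointsSection s (toConv (p : B →ₐ[C] A)) =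
        toConv (AlgHom.id C A))
    {g : WithConv (A →ₐ[C] T)} {z : WithConv (AdditiveGroupRing C →ₐ[C] T)}
    {x : WithConv (B →ₐ[C] T)} (h : pointsPull T i z * pointsSection s x = g) :
    toConv (g.ofConv.comp t) = z ∧ pointsPull T p g = x := by
  have hx : pointsPull T p g = x := by
    rw [← h, map_mul, hext.pointsPull_pointsPull, pointsPull_pointsSection hs, one_mul]
  refine ⟨?_, hx⟩
  have h1 := (pointsPull_mul_pointsSection ht g).trans h.symm
  rw [hx] at h1
  have h2 := congrArg (· * pointsInv (pointsSection s x)) h1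
  simp only [mul_assoc, mul_pointsInv, mul_one] at h2
  exact WithConv.ofConv_injective ((AlgHom.cancel_right hext.surjective).1
    (congrArg WithConv.ofConv h2))

/-- If `G → Ḡ` has a section as varieties, then `C[G]` is a polynomial ring `C[Ḡ][Y]` whose variable
satisfies `Y(gh) = Y(g) + Y(h) + f(ḡ, h̄)`, where `f` is the cocycle of the extension. -/
theorem IsCentralExtension.exists_coordinate (hext : IsCentralExtension p i) {s : A →ₐ[C] B}
    (hs : ∀ b, s (p b) = b) :
    ∃ (e : Polynomial B ≃ₐ[C] A) (f : B ⊗[C] B), (∀ b, e (Polynomial.C b) = p b) ∧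
      comul (R := C) (e Polynomial.X) = e Polynomial.X ⊗ₜ[C] 1 + 1 ⊗ₜ[C] e Polynomial.X +
        TensorProduct.map (p : B →ₗ[C] A) (p : B →ₗ[C] A) f := by
  obtain ⟨t, ht⟩ := hext.exists_retraction hs
  -- Writing `τ(g)` for the component of `g` in `𝔾ₐ`, centrality gives
  -- `τ(gh) = τ(g) τ(h) τ(σ(ḡ) σ(h̄))`; the last factor depends only on `ḡ` and `h̄`.
  have hmul (g h : WithConv (A →ₐ[C] (A ⊗[C] A))) :
      (g * h).ofConv (t (SymmetricAlgebra.ι C C 1)) =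
        g.ofConv (t (SymmetricAlgebra.ι C C 1)) + h.ofConv (t (SymmetricAlgebra.ι C C 1)) +
          (pointsSection s (pointsPull _ p g) * pointsSection s (pointsPull _ p h)).ofConv
            (t (SymmetricAlgebra.ι C C 1)) := by
    set k := pointsSection s (pointsPull _ p g) * pointsSection s (pointsPull _ p h) with hk
    have hkp : pointsPull _ p k = pointsPull _ p (g * h) := by
      rw [hk, map_mul, map_mul, pointsPull_pointsSection hs, pointsPull_pointsSection hs]
    -- The point `k = σ(ḡ) σ(h̄)` has the same image in `Ḡ` as `gh`.
    have hdec : pointsPull _ i (toConv (g.ofConv.comp t) * toConv (h.ofConv.comp t) *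
        toConv (k.ofConv.comp t)) * pointsSection s (pointsPull _ p k) = g * h := by
      rw [map_mul, mul_assoc, pointsPull_mul_pointsSection ht, hk, map_mul]
      conv_rhs => rw [← pointsPull_mul_pointsSection ht g, ← pointsPull_mul_pointsSection ht h]
      rw [mul_assoc, mul_assoc, ← mul_assoc (pointsPull _ i (toConv (h.ofConv.comp t))),
        hext.pointsPull_mul_comm (toConv (h.ofConv.comp t))]
      simp only [mul_assoc]
    have h1 := congrArg (fun z : WithConv (AdditiveGroupRing C →ₐ[C] A ⊗[C] A) =>
        z.ofConv (SymmetricAlgebra.ι C C 1))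
      (hext.comp_eq_of_mul_eq hs ht hdec).1
    simp only [convMul_ι_one] at h1
    exact h1
  -- The mutually inverse maps between `𝔾ₐ × Ḡ` and `G`: `φ` is dual to `(z, x) ↦ z σ(x)`, and
  -- `ψ` to `g ↦ (g σ(ḡ)⁻¹, ḡ)`.
  let φ : A →ₐ[C] B ⊗[C] AdditiveGroupRing C :=
    (pointsPull _ i (toConv Algebra.TensorProduct.includeRight) *
      pointsSection s (toConv Algebra.TensorProduct.includeLeft)).ofConv
  let ψ : B ⊗[C] AdditiveGroupRing C →ₐ[C] A := Algebra.TensorProduct.productMap p t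
  have hφ := hext.comp_eq_of_mul_eq hs ht (g := toConv φ) rfl
  have hψr : ψ.comp Algebra.TensorProduct.includeRight = t :=
    Algebra.TensorProduct.productMap_right _ _
  have hψl : ψ.comp Algebra.TensorProduct.includeLeft = (p : B →ₐ[C] A) :=
    Algebra.TensorProduct.productMap_left _ _
  have hψφ : ψ.comp φ = AlgHom.id C A := by
    have h : pointsMap A ψ (toConv φ) = pointsPull A i
        (toConv (ψ.comp Algebra.TensorProduct.includeRight)) * pointsSection s
          (toConv (ψ.comp Algebra.TensorProduct.includeLeft)) := map_mul (pointsMap A ψ) _ _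
    rw [hψr, hψl, ht] at h
    exact congrArg WithConv.ofConv h
  have hφψ : φ.comp ψ = AlgHom.id C _ := by
    apply Algebra.TensorProduct.ext
    · change φ.comp (ψ.comp Algebra.TensorProduct.includeLeft) = _
      rw [hψl]
      exact congrArg WithConv.ofConv hφ.2
    · change φ.comp (ψ.comp Algebra.TensorProduct.includeRight) = _
      rw [hψr]
      exact congrArg WithConv.ofConv hφ.1
  let e₁ : Polynomial C ≃ₐ[C] AdditiveGroupRing C :=
    AlgEquiv.ofAlgHom (Polynomial.aeval (SymmetricAlgebra.ι C C 1))
      (SymmetricAlgebra.lift (LinearMap.toSpanSingleton C (Polynomial C) Polynomial.X))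
      (by ext; simp) (by ext; simp)
  let e : Polynomial B ≃ₐ[C] A := ((polyEquivTensor C B).trans
    (Algebra.TensorProduct.congr AlgEquiv.refl e₁)).trans (AlgEquiv.ofAlgHom ψ φ hψφ hφψ)
  have hX : e Polynomial.X = t (SymmetricAlgebra.ι C C 1) := by
    simp [e, e₁, ψ]
  refine ⟨e, (pointsSection s (toConv Algebra.TensorProduct.includeLeft) *
    pointsSection s (toConv Algebra.TensorProduct.includeRight)).ofConv
      (t (SymmetricAlgebra.ι C C 1)), fun b => by simp [e, e₁, ψ], ?_⟩
  rw [hX]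
  have h := hmul (toConv Algebra.TensorProduct.includeLeft)
    (toConv Algebra.TensorProduct.includeRight)
  rw [← toConv_comulAlgHom] at h
  refine h.trans (congrArg₂ (· + ·) rfl ?_)
  let m : B ⊗[C] B →ₐ[C] A ⊗[C] A :=
    Algebra.TensorProduct.map (p : B →ₐ[C] A) (p : B →ₐ[C] A)
  have hl : (Algebra.TensorProduct.includeLeft : A →ₐ[C] A ⊗[C] A).comp (p : B →ₐ[C] A) =
      m.comp Algebra.TensorProduct.includeLeft := by ext; simp [m]
  have hr : (Algebra.TensorProduct.includeRight : A →ₐ[C] A ⊗[C] A).comp (p : B →ₐ[C] A) =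
      m.comp Algebra.TensorProduct.includeRight := by ext; simp [m]
  have hl' : pointsSection s (pointsPull _ p (toConv Algebra.TensorProduct.includeLeft)) =
      pointsMap A m (pointsSection s (toConv Algebra.TensorProduct.includeLeft)) :=
    congrArg (fun g => pointsSection s (toConv g)) hl
  have hr' : pointsSection s (pointsPull _ p (toConv Algebra.TensorProduct.includeRight)) =
      pointsMap A m (pointsSection s (toConv Algebra.TensorProduct.includeRight)) :=
    congrArg (fun g => pointsSection s (toConv g)) hr
  rw [hl', hr', ← map_mul]
  rfl

end CentralExtension

/-! ### Equivariant derivations and tangent vectors at the identity -/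

section Equivariant

variable {C F A B : Type*} [Field C] [Field F] [Algebra C F]
  [CommRing A] [HopfAlgebra C A] [CommRing B] [HopfAlgebra C B]

variable (C F A) in
/-- Evaluation at the identity, `F[G] → F`. -/
def evalOne : F ⊗[C] A →ₐ[C] F :=
  Algebra.TensorProduct.productMap (AlgHom.id C F)
    ((Algebra.ofId C F).comp (Bialgebra.counitAlgHom C A))

theorem evalOne_tmul (a : F) (x : A) :
    evalOne C F A (a ⊗ₜ x) = a * algebraMap C F (counit (R := C) x) := rfl

theorem translation_tmul (a : F) (x : A) :
    translation C F A (a ⊗ₜ x) =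
      (TensorProduct.assoc C F A A).symm (a ⊗ₜ comul (R := C) x) := rfl

/-- Restricting `(g, h) ↦ f(gh)` to `g = 1` gives back `f`. -/
theorem rTensor_evalOne_translation (x : F ⊗[C] A) :
    (evalOne C F A : F ⊗[C] A →ₗ[C] F).rTensor A (translation C F A x) = x := by
  induction x with
  | zero => simp
  | add x y hx hy => simp only [map_add, hx, hy]
  | tmul a x =>
    rw [translation_tmul]
    have h (t : A ⊗[C] A) : (evalOne C F A : F ⊗[C] A →ₗ[C] F).rTensor A
        ((TensorProduct.assoc C F A A).symm (a ⊗ₜ t)) =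
          (TensorProduct.map (LinearMap.toSpanSingleton C F a) LinearMap.id)
            ((counit (R := C) (A := A)).rTensor A t) := by
      induction t with
      | zero => simp
      | add x y hx hy => simp only [map_add, TensorProduct.tmul_add, hx, hy]
      | tmul y z =>
        simp [evalOne_tmul, Algebra.smul_def, mul_comm]
    rw [h, rTensor_counit_comul]
    simp

/-- The `C`-linear endomorphism `a ⊗ x ↦ DF(a) ⊗ x + ∑ a δ(x₁) ⊗ x₂` of `F[G]`, for a linear form
`δ : C[G] → F`. -/
def invariantMap (DF : Derivation C F F) (δ : A →ₗ[C] F) : F ⊗[C] A →ₗ[C] F ⊗[C] A :=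
  (DF : F →ₗ[C] F).rTensor A +
    (LinearMap.mul' C F ∘ₗ δ.lTensor F).rTensor A ∘ₗ translation C F A

theorem invariantMap_tmul (DF : Derivation C F F) (δ : A →ₗ[C] F) (a : F) (x : A) :
    invariantMap DF δ (a ⊗ₜ x) =
      DF a ⊗ₜ x + (a ⊗ₜ 1) * δ.rTensor A (comul (R := C) x) := by
  have h (t : A ⊗[C] A) : (LinearMap.mul' C F ∘ₗ δ.lTensor F).rTensor A
      ((TensorProduct.assoc C F A A).symm (a ⊗ₜ t)) = (a ⊗ₜ 1) * δ.rTensor A t := by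
    induction t with
    | zero => simp
    | add x y hx hy => simp only [map_add, TensorProduct.tmul_add, hx, hy, mul_add]
    | tmul y z => simp
  simp [invariantMap, translation_tmul, h]

/-- A linear form `δ : C[G] → F` is a tangent vector at the identity if it is a derivation over the
counit. -/
def IsTangent (δ : A →ₗ[C] F) : Prop :=
  ∀ x y : A, δ (x * y) = counit (R := C) x • δ y + counit (R := C) y • δ x

theorem IsTangent.map_one {δ : A →ₗ[C] F} (hδ : IsTangent δ) : δ 1 = 0 := by
  simpa using hδ 1 1

theorem IsTangent.rTensor_comul_mul {δ : A →ₗ[C] F} (hδ : IsTangent δ) (x y : A) :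
    δ.rTensor A (comul (R := C) (x * y)) =
      (1 ⊗ₜ x) * δ.rTensor A (comul (R := C) y) + (1 ⊗ₜ y) * δ.rTensor A (comul (R := C) x) := by
  have h (t u : A ⊗[C] A) : δ.rTensor A (t * u) =
      (1 ⊗ₜ TensorProduct.lid C A ((counit (R := C)).rTensor A t)) * δ.rTensor A u +
        (1 ⊗ₜ TensorProduct.lid C A ((counit (R := C)).rTensor A u)) * δ.rTensor A t := by
    induction t with
    | zero => simp
    | add x y hx hy =>
      simp only [map_add, TensorProduct.tmul_add, hx, hy, add_mul, mul_add]; abel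
    | tmul x y =>
      induction u with
      | zero => simp
      | add x y hx hy =>
        simp only [map_add, TensorProduct.tmul_add, hx, hy, add_mul, mul_add]; abel
      | tmul z w =>
        simp [hδ x z, TensorProduct.add_tmul, TensorProduct.smul_tmul, mul_comm y w]
  rw [Bialgebra.comul_mul, h, rTensor_counit_comul, rTensor_counit_comul]
  simp

/-- A tangent vector `δ` of `G` at the identity, with values in `F`, gives a derivation of `F[G]`
extending the one of `F`. -/
def invariantDerivation (DF : Derivation C F F) (δ : A →ₗ[C] F) (hδ : IsTangent δ) :
    Derivation C (F ⊗[C] A) (F ⊗[C] A) :=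
  Derivation.mk' (invariantMap DF δ) fun u v => by
    induction u with
    | zero => simp
    | add x y hx hy => simp only [map_add, add_mul, hx, hy, add_smul, smul_add]; abel
    | tmul a x =>
      induction v with
      | zero => simp
      | add x y hx hy => simp only [map_add, mul_add, hx, hy, add_smul, smul_add]; abel
      | tmul b y =>
        have h1 (c : F) (z : A) : (c ⊗ₜ[C] z : F ⊗[C] A) = (c ⊗ₜ 1) * (1 ⊗ₜ z) := by simp
        rw [Algebra.TensorProduct.tmul_mul_tmul, invariantMap_tmul, invariantMap_tmul,
          invariantMap_tmul, hδ.rTensor_comul_mul, Derivation.leibniz, TensorProduct.add_tmul]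
        simp only [smul_eq_mul]
        rw [h1 a x, h1 b y, h1 (a * DF b) (x * y), h1 (b * DF a) (x * y), h1 (DF a) x,
          h1 (DF b) y]
        have h2 (c d : F) : ((c * d) ⊗ₜ[C] (1 : A) : F ⊗[C] A) = (c ⊗ₜ 1) * (d ⊗ₜ 1) := by simp
        have h3 : ((1 : F) ⊗ₜ[C] (x * y) : F ⊗[C] A) = (1 ⊗ₜ x) * (1 ⊗ₜ y) := by simp
        rw [h2, h2, h2, h3]
        ring

theorem invariantDerivation_tmul (DF : Derivation C F F) {δ : A →ₗ[C] F} (hδ : IsTangent δ)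
    (a : F) (x : A) : invariantDerivation DF δ hδ (a ⊗ₜ x) =
      DF a ⊗ₜ x + (a ⊗ₜ 1) * δ.rTensor A (comul (R := C) x) :=
  invariantMap_tmul DF δ a x

theorem isEquivariant_invariantDerivation (DF : Derivation C F F) {δ : A →ₗ[C] F}
    (hδ : IsTangent δ) : IsEquivariant (invariantDerivation DF δ hδ) := by
  intro f
  induction f with
  | zero => simp
  | add x y hx hy => simp only [map_add, hx, hy]
  | tmul a x =>
    have h1 (u : F ⊗[C] A) : translation C F A ((a ⊗ₜ 1) * u) =
        ((a ⊗ₜ 1) ⊗ₜ 1) * translation C F A u := by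
      induction u with
      | zero => simp
      | add x y hx hy => simp only [map_add, mul_add, hx, hy]
      | tmul b y =>
        rw [Algebra.TensorProduct.tmul_mul_tmul, one_mul, translation_tmul, translation_tmul]
        induction comul (R := C) y with
        | zero => simp
        | add x y hx hy => simp only [map_add, TensorProduct.tmul_add, mul_add, hx, hy]
        | tmul z w => simp
    have h2 (t : A ⊗[C] A) : translation C F A (δ.rTensor A t) =
        (δ.rTensor A).rTensor A ((TensorProduct.assoc C A A A).symm
          ((comul (R := C) (A := A)).lTensor A t)) := by
      induction t with
      | zero => simp
      | add x y hx hy => simp only [map_add, hx, hy]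
      | tmul y z =>
        rw [LinearMap.rTensor_tmul, translation_tmul, LinearMap.lTensor_tmul]
        induction comul (R := C) z with
        | zero => simp
        | add x y hx hy => simp only [map_add, TensorProduct.tmul_add, hx, hy]
        | tmul z w => simp
    have h3 (t : A ⊗[C] A) :
        (invariantDerivation DF δ hδ : F ⊗[C] A →ₗ[C] F ⊗[C] A).rTensor A
          ((TensorProduct.assoc C F A A).symm (a ⊗ₜ t)) =
        (TensorProduct.assoc C F A A).symm (DF a ⊗ₜ t) +
          ((a ⊗ₜ 1) ⊗ₜ 1) * (δ.rTensor A ∘ₗ comul (R := C)).rTensor A t := by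
      induction t with
      | zero => simp
      | add x y hx hy => simp only [map_add, TensorProduct.tmul_add, mul_add, hx, hy]; abel
      | tmul y z => simp [invariantDerivation_tmul, TensorProduct.add_tmul]
    rw [invariantDerivation_tmul, map_add, h1, h2, coassoc_symm_apply, translation_tmul,
      translation_tmul, h3, LinearMap.rTensor_comp_apply]

/-- The tangent vector at the identity determined by a derivation of `F[G]`. -/
def tangentOf (D : Derivation C (F ⊗[C] A) (F ⊗[C] A)) : A →ₗ[C] F :=
  (evalOne C F A : F ⊗[C] A →ₗ[C] F) ∘ₗ (D : F ⊗[C] A →ₗ[C] F ⊗[C] A) ∘ₗ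
    TensorProduct.mk C F A 1

theorem isTangent_tangentOf (D : Derivation C (F ⊗[C] A) (F ⊗[C] A)) :
    IsTangent (tangentOf D) := by
  intro x y
  have h : (1 ⊗ₜ (x * y) : F ⊗[C] A) = (1 ⊗ₜ x) * (1 ⊗ₜ y) := by simp
  simp only [tangentOf, LinearMap.comp_apply, TensorProduct.mk_apply,
    Derivation.coeFn_coe]
  rw [h, Derivation.leibniz]
  simp [evalOne_tmul, Algebra.smul_def]

/-- An equivariant derivation extending the one of `F` is determined by its tangent vector at the
identity. -/
theorem IsEquivariant.apply_tmul {DF : Derivation C F F}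
    {D : Derivation C (F ⊗[C] A) (F ⊗[C] A)} (hequiv : IsEquivariant D) (hD : ExtendsBase DF D)
    (a : F) (x : A) :
    D (a ⊗ₜ x) = DF a ⊗ₜ x + (a ⊗ₜ 1) * (tangentOf D).rTensor A (comul (R := C) x) := by
  have h : (a ⊗ₜ[C] x : F ⊗[C] A) = (a ⊗ₜ 1) * (1 ⊗ₜ x) := by simp
  have h1 : D (1 ⊗ₜ x) = (tangentOf D).rTensor A (comul (R := C) x) := by
    rw [← rTensor_evalOne_translation (D (1 ⊗ₜ x)), hequiv, translation_tmul,
      ← LinearMap.rTensor_comp_apply]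
    induction comul (R := C) x with
    | zero => simp
    | add x y hx hy => simp only [map_add, TensorProduct.tmul_add, hx, hy]
    | tmul y z => rfl
  rw [h, Derivation.leibniz, hD, h1, smul_eq_mul, smul_eq_mul]
  rw [add_comm]
  simp

end Equivariant

/-! ### Splitting the extension from a constant -/

section Splitting

variable {C F A B : Type*} [Field C] [Field F] [Algebra C F]
  [CommRing A] [HopfAlgebra C A] [CommRing B] [HopfAlgebra C B]

theorem exists_polynomial_algEquiv_tensorProduct (e : Polynomial B ≃ₐ[C] A) {p : B →ₐ[C] A}
    (he : ∀ b, e (Polynomial.C b) = p b) :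
    ∃ e' : Polynomial (F ⊗[C] B) ≃ₐ[C] F ⊗[C] A,
      (∀ x, e' (Polynomial.C x) = Algebra.TensorProduct.map (AlgHom.id C F) p x) ∧
        e' Polynomial.X = 1 ⊗ₜ e Polynomial.X := by
  let e' : Polynomial (F ⊗[C] B) ≃ₐ[C] F ⊗[C] A :=
    ((polyEquivTensor C (F ⊗[C] B)).trans
      (Algebra.TensorProduct.assoc C C C F B (Polynomial C))).trans
      (Algebra.TensorProduct.congr AlgEquiv.refl ((polyEquivTensor C B).symm.trans e))
  refine ⟨e', fun x => ?_, ?_⟩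
  · induction x with
    | zero => simp
    | add x y hx hy => simp only [map_add, hx, hy]
    | tmul a b => simp [e', he, polyEquivTensor_symm_apply_tmul_eq_smul, Polynomial.smul_eq_C_mul]
  · simp [e', Algebra.TensorProduct.one_def, polyEquivTensor_symm_apply_tmul_eq_smul]

theorem algHom_ext_of_polynomial (e : Polynomial B ≃ₐ[C] A) {p : B →ₐ[C] A}
    (he : ∀ b, e (Polynomial.C b) = p b) {S : Type*} [CommRing S] [Algebra C S] {f g : A →ₐ[C] S}
    (h1 : ∀ b, f (p b) = g (p b)) (h2 : f (e Polynomial.X) = g (e Polynomial.X)) : f = g := by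
  have h : (f : A →+* S).comp (e : Polynomial B →+* A) =
      (g : A →+* S).comp (e : Polynomial B →+* A) := by
    apply Polynomial.ringHom_ext
    · intro b
      simp [he, h1]
    · simpa using h2
  ext a
  simpa using RingHom.congr_fun h (e.symm a)

/-- If some translate of the coordinate `Y` by a function on `Ḡ` is primitive, then the section
killing it is a homomorphism. -/
theorem exists_bialgHom_section {p : B →ₐc[C] A} (e : Polynomial B ≃ₐ[C] A)
    (he : ∀ b, e (Polynomial.C b) = p b) {b : B} {χ : A} (hχ : χ = e Polynomial.X - p b)
    (hprim : comul (R := C) χ = χ ⊗ₜ 1 + 1 ⊗ₜ χ) :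
    ∃ t : A →ₐc[C] B, ∀ b, t (p b) = b := by
  let t : A →ₐ[C] B :=
    ((Polynomial.aeval b).restrictScalars C).comp (e.symm : A →ₐ[C] Polynomial B)
  have htp (b : B) : t (p b) = b := by simp [t, ← he]
  have htX : t (e Polynomial.X) = b := by simp [t]
  have htχ : t χ = 0 := by rw [hχ, map_sub, htX, htp, sub_self]
  have hX : e Polynomial.X = χ + p b := by rw [hχ, sub_add_cancel]
  have hεχ : counit (R := C) χ = 0 := by
    have h := rTensor_counit_comul (R := C) χ
    rw [hprim, map_add, LinearMap.rTensor_tmul, LinearMap.rTensor_tmul, Bialgebra.counit_one,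
      add_eq_right] at h
    simpa using congrArg (fun u => counit (R := C) (TensorProduct.lid C A u)) h
  have hεt : (Bialgebra.counitAlgHom C B).comp t = Bialgebra.counitAlgHom C A := by
    apply algHom_ext_of_polynomial (p := (p : B →ₐ[C] A)) e he
    · intro b
      simp [htp]
    · change counit (R := C) (t (e Polynomial.X)) = counit (R := C) (e Polynomial.X)
      rw [htX, hX, map_add, hεχ, zero_add, CoalgHomClass.counit_comp_apply]
  have hΔt : (Algebra.TensorProduct.map t t).comp (Bialgebra.comulAlgHom C A) =
      (Bialgebra.comulAlgHom C B).comp t := by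
    have h (b : B) : Algebra.TensorProduct.map t t (comul (R := C) (p b)) = comul (R := C) b := by
      rw [← CoalgHomClass.map_comp_comul_apply]
      induction comul (R := C) b with
      | zero => simp
      | add x y hx hy => simp only [map_add, hx, hy]
      | tmul x y => simp [htp]
    apply algHom_ext_of_polynomial (p := (p : B →ₐ[C] A)) e he
    · intro b
      simp [htp, h]
    · change Algebra.TensorProduct.map t t (comul (R := C) (e Polynomial.X)) =
        comul (R := C) (t (e Polynomial.X))
      rw [htX, hX, map_add, map_add, h, hprim]
      simp [htχ]
  exact ⟨BialgHom.ofAlgHom t hεt hΔt, htp⟩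

theorem SplitsAsGroupsOver.of_bialgHom {p : B →ₐc[C] A} {t : A →ₐc[C] B}
    (ht : ∀ b, t (p b) = b) : SplitsAsGroupsOver F p := by
  refine ⟨Bialgebra.TensorProduct.map (BialgHom.id F F) t, fun x => ?_⟩
  induction x with
  | zero => simp
  | add x y hx hy => simp only [map_add, hx, hy]
  | tmul a b => simp [ht]

/-- By flatness, if the kernel of `D` is spanned by `v`, then that of `D ⊗ id` is `v ⊗ W`. -/
theorem exists_eq_tmul_of_rTensor_eq_zero {V W : Type*} [AddCommGroup V] [Module C V]
    [AddCommGroup W] [Module C W] {D : V →ₗ[C] V} {v : V} (hv : D v = 0)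
    (h : ∀ u, D u = 0 → ∃ c : C, c • v = u) {t : V ⊗[C] W} (ht : D.rTensor W t = 0) :
    ∃ w : W, t = v ⊗ₜ w := by
  have hex : Function.Exact (LinearMap.toSpanSingleton C V v) D := by
    intro u
    constructor
    · exact h u
    · rintro ⟨c, rfl⟩
      simp [hv]
  obtain ⟨s, rfl⟩ := (Module.Flat.rTensor_exact W hex t).1 ht
  refine ⟨TensorProduct.lid C W s, ?_⟩
  clear ht
  induction s with
  | zero => simp
  | add x y hx hy => simp only [map_add, TensorProduct.tmul_add, hx, hy]
  | tmul c w => simp [TensorProduct.smul_tmul]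

/-- If `Y - x` is a constant of `F[G]` for some `x ∈ F[Ḡ]`, then the extension splits. Indeed,
translating `Y - x` by an element `h` of `G` changes it by an element of `F[Ḡ]` which is again
constant, so lies in `C`; this gives a homomorphism `χ : G → 𝔾ₐ` differing from `Y` by a function on
`Ḡ`, whose kernel is a complement of `𝔾ₐ`. -/
theorem exists_bialgHom_section_of_constant {p : B →ₐc[C] A} (hp : Function.Injective p)
    (e : Polynomial B ≃ₐ[C] A) (he : ∀ b, e (Polynomial.C b) = p b) {f : B ⊗[C] B}
    (hf : comul (R := C) (e Polynomial.X) = e Polynomial.X ⊗ₜ[C] 1 + 1 ⊗ₜ[C] e Polynomial.X +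
        TensorProduct.map (p : B →ₗ[C] A) (p : B →ₗ[C] A) f)
    {D : Derivation C (F ⊗[C] B) (F ⊗[C] B)}
    (hconst : ∀ x, D x = 0 → x ∈ (algebraMap C (F ⊗[C] B)).range)
    {D' : Derivation C (F ⊗[C] A) (F ⊗[C] A)} (hequiv : IsEquivariant D')
    {P : F ⊗[C] B →ₐ[C] F ⊗[C] A} (hP : P = Algebra.TensorProduct.map (AlgHom.id C F) p)
    (hDD' : ∀ x, D' (P x) = P (D x)) {x : F ⊗[C] B}
    (hx : D' (1 ⊗ₜ e Polynomial.X - P x) = 0) :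
    ∃ t : A →ₐc[C] B, ∀ b, t (p b) = b := by
  set Y : A := e Polynomial.X with hY
  set w : F ⊗[C] A := 1 ⊗ₜ Y - P x with hw
  have htr (a : A) : translation C F A (1 ⊗ₜ a) =
      (TensorProduct.mk C F A 1).rTensor A (comul (R := C) a) := by
    rw [translation_tmul]
    induction comul (R := C) a with
    | zero => simp
    | add x y hx hy => simp only [map_add, TensorProduct.tmul_add, hx, hy]
    | tmul y z => simp
  have htrP (z : F ⊗[C] B) : translation C F A (P z) =
      TensorProduct.map (P : F ⊗[C] B →ₗ[C] F ⊗[C] A) (p : B →ₗ[C] A) (translation C F B z) := by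
    induction z with
    | zero => simp
    | add x y hx hy => simp only [map_add, hx, hy]
    | tmul a b =>
      rw [hP, Algebra.TensorProduct.map_tmul, translation_tmul, translation_tmul]
      have hΔ := (CoalgHomClass.map_comp_comul_apply p b).symm
      have h (u : B ⊗[C] B) : (TensorProduct.assoc C F A A).symm
          (a ⊗ₜ TensorProduct.map (p : B →ₗ[C] A) (p : B →ₗ[C] A) u) =
          TensorProduct.map ((Algebra.TensorProduct.map (AlgHom.id C F) (p : B →ₐ[C] A) :
            F ⊗[C] B →ₐ[C] F ⊗[C] A) : F ⊗[C] B →ₗ[C] F ⊗[C] A) (p : B →ₗ[C] A)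
            ((TensorProduct.assoc C F B B).symm (a ⊗ₜ u)) := by
        induction u with
        | zero => simp
        | add x y hx hy => simp only [map_add, TensorProduct.tmul_add, hx, hy]
        | tmul y z => simp
      rw [← h]
      exact congrArg (fun u => (TensorProduct.assoc C F A A).symm (a ⊗ₜ u)) hΔ
  have hPinj : Function.Injective P := by
    rw [hP]
    exact Module.Flat.lTensor_preserves_injective_linearMap (p : B →ₗ[C] A) hp
  -- `translation w - w ⊗ 1` lies in `F[Ḡ] ⊗ C[G]`
  let v : (F ⊗[C] B) ⊗[C] A := (1 ⊗ₜ Y) +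
    TensorProduct.map (TensorProduct.mk C F B 1) (p : B →ₗ[C] A) f -
      (p : B →ₗ[C] A).lTensor (F ⊗[C] B) (translation C F B x) + x ⊗ₜ 1
  have hv : (P : F ⊗[C] B →ₗ[C] F ⊗[C] A).rTensor A v = translation C F A w - w ⊗ₜ 1 := by
    have h1 (u : B ⊗[C] B) : (P : F ⊗[C] B →ₗ[C] F ⊗[C] A).rTensor A
        (TensorProduct.map (TensorProduct.mk C F B 1) (p : B →ₗ[C] A) u) =
        (TensorProduct.mk C F A 1).rTensor A
          (TensorProduct.map (p : B →ₗ[C] A) (p : B →ₗ[C] A) u) := by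
      induction u with
      | zero => simp
      | add x y hx hy => simp only [map_add, hx, hy]
      | tmul y z => simp [hP]
    have h2 (u : (F ⊗[C] B) ⊗[C] B) : (P : F ⊗[C] B →ₗ[C] F ⊗[C] A).rTensor A
        ((p : B →ₗ[C] A).lTensor (F ⊗[C] B) u) =
        TensorProduct.map (P : F ⊗[C] B →ₗ[C] F ⊗[C] A) (p : B →ₗ[C] A) u := by
      rw [← LinearMap.comp_apply, LinearMap.rTensor_comp_lTensor]
    rw [hw, map_sub, htr, htrP, hf, map_add, map_add, map_add, map_sub, map_add, h1, h2]
    have h3 (z : F ⊗[C] B) : (P : F ⊗[C] B →ₗ[C] F ⊗[C] A) z = P z := rfl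
    simp only [LinearMap.rTensor_tmul, TensorProduct.mk_apply, TensorProduct.sub_tmul, h3,
      ← Algebra.TensorProduct.one_def, map_one]
    abel
  have hDv : (D : F ⊗[C] B →ₗ[C] F ⊗[C] B).rTensor A v = 0 := by
    apply Module.Flat.rTensor_preserves_injective_linearMap (M := A)
      (P : F ⊗[C] B →ₗ[C] F ⊗[C] A) hPinj
    have hcomp : (P : F ⊗[C] B →ₗ[C] F ⊗[C] A) ∘ₗ (D : F ⊗[C] B →ₗ[C] F ⊗[C] B) =
        (D' : F ⊗[C] A →ₗ[C] F ⊗[C] A) ∘ₗ (P : F ⊗[C] B →ₗ[C] F ⊗[C] A) :=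
      LinearMap.ext fun z => (hDD' z).symm
    rw [← LinearMap.rTensor_comp_apply, hcomp, LinearMap.rTensor_comp_apply, hv, map_sub,
      ← hequiv, hx, map_zero, map_zero, LinearMap.rTensor_tmul]
    simp [hx]
  obtain ⟨χ, hχ⟩ := exists_eq_tmul_of_rTensor_eq_zero (v := (1 : F ⊗[C] B))
    (by simp) (fun u hu => by
      obtain ⟨c, hc⟩ := hconst u hu
      exact ⟨c, by rw [← hc, Algebra.algebraMap_eq_smul_one]⟩) hDv
  have htw : translation C F A w = w ⊗ₜ 1 + 1 ⊗ₜ χ := by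
    rw [hχ] at hv
    rw [← sub_eq_iff_eq_add', ← hv]
    simp
  set c : F := evalOne C F A w with hc
  -- Restrict `w(gh) = w(g) + χ(h)` to `g = 1`.
  have hwχ : w = c ⊗ₜ 1 + 1 ⊗ₜ χ := by
    have h := congrArg ((evalOne C F A : F ⊗[C] A →ₗ[C] F).rTensor A) htw
    rw [rTensor_evalOne_translation] at h
    simpa using h
  -- A linear retraction of `C → F` brings the relation between `χ` and `Y` down to `C[G]`.
  obtain ⟨l, hl⟩ : ∃ l : F →ₗ[C] C, l 1 = 1 := by
    obtain ⟨l, hl⟩ := (Algebra.linearMap C F).exists_leftInverse_of_injective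
      (LinearMap.ker_eq_bot.2 (algebraMap C F).injective)
    exact ⟨l, by simpa using LinearMap.congr_fun hl 1⟩
  have hχY : χ = Y - p (TensorProduct.lid C B (l.rTensor B (x + c ⊗ₜ 1))) := by
    have h1 (z : F ⊗[C] B) : TensorProduct.lid C A (l.rTensor A (P z)) =
        p (TensorProduct.lid C B (l.rTensor B z)) := by
      induction z with
      | zero => simp
      | add x y hx hy => simp only [map_add, hx, hy]
      | tmul a b => simp [hP]
    have h2 : (1 : F) ⊗ₜ[C] χ = 1 ⊗ₜ Y - P (x + c ⊗ₜ 1) := by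
      have h3 : P (c ⊗ₜ 1) = c ⊗ₜ 1 := by simp [hP]
      rw [map_add, h3, ← sub_sub, ← hw, hwχ, add_sub_cancel_left]
    have h4 := congrArg (fun z => TensorProduct.lid C A (l.rTensor A z)) h2
    simp only [map_sub, h1] at h4
    simpa [hl] using h4
  refine exists_bialgHom_section e he hχY ?_
  clear_value w
  have h1 : translation C F A (1 ⊗ₜ χ) = (1 ⊗ₜ χ) ⊗ₜ 1 + 1 ⊗ₜ χ := by
    have h2 : translation C F A (c ⊗ₜ 1) = (c ⊗ₜ 1) ⊗ₜ 1 := by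
      simp [translation_tmul, Algebra.TensorProduct.one_def]
    have h3 : (1 : F) ⊗ₜ[C] χ = w - c ⊗ₜ 1 := by rw [hwχ, add_sub_cancel_left]
    rw [h3, map_sub, htw, h2, TensorProduct.sub_tmul]
    abel
  have h2 : (TensorProduct.lid C A).toLinearMap ∘ₗ l.rTensor A ∘ₗ TensorProduct.mk C F A 1 =
      LinearMap.id := by ext; simp [hl]
  have h3 := congrArg (((TensorProduct.lid C A).toLinearMap ∘ₗ l.rTensor A).rTensor A) h1
  rw [htr, ← LinearMap.rTensor_comp_apply, LinearMap.comp_assoc, h2, LinearMap.rTensor_id_apply,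
    Algebra.TensorProduct.one_def] at h3
  simpa [hl] using h3

end Splitting

/-! ### Extending the derivation -/

section Extension

variable {C F A B : Type*} [Field C] [Field F] [Algebra C F]
  [CommRing A] [HopfAlgebra C A] [CommRing B] [HopfAlgebra C B]

/-- A tangent vector of `Ḡ` at the identity lifts to `G` along a section `Ḡ → G` that preserves the
identity. -/
theorem IsTangent.comp_section {δ : B →ₗ[C] F} (hδ : IsTangent δ) {s : A →ₐ[C] B}
    (hs : ∀ a, counit (R := C) (s a) = counit (R := C) a) :
    IsTangent (δ ∘ₗ (s : A →ₗ[C] B)) := by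
  intro x y
  change δ (s (x * y)) = counit (R := C) x • δ (s y) + counit (R := C) y • δ (s x)
  rw [map_mul, hδ, hs, hs]

theorem rTensor_comp_section_map {p : B →ₐc[C] A} {s : A →ₐ[C] B} (hs : ∀ b, s (p b) = b)
    (δ : B →ₗ[C] F) (u : B ⊗[C] B) :
    (δ ∘ₗ (s : A →ₗ[C] B)).rTensor A
        (TensorProduct.map (p : B →ₗ[C] A) (p : B →ₗ[C] A) u) =
      Algebra.TensorProduct.map (AlgHom.id C F) (p : B →ₐ[C] A) (δ.rTensor B u) := by
  induction u with
  | zero => simp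
  | add x y hx hy => simp only [map_add, hx, hy]
  | tmul x y => simp [hs]

/-- The derivation of `F[G]` defined by a lift of the tangent vector of `D` extends `D`. -/
theorem invariantDerivation_map {DF : Derivation C F F} {D : Derivation C (F ⊗[C] B) (F ⊗[C] B)}
    (hequiv : IsEquivariant D) (hD : ExtendsBase DF D) {p : B →ₐc[C] A} {s : A →ₐ[C] B}
    (hs : ∀ b, s (p b) = b) (hδ : IsTangent (tangentOf D ∘ₗ (s : A →ₗ[C] B))) (x : F ⊗[C] B) :
    invariantDerivation DF _ hδ
        (Algebra.TensorProduct.map (AlgHom.id C F) (p : B →ₐ[C] A) x) =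
      Algebra.TensorProduct.map (AlgHom.id C F) (p : B →ₐ[C] A) (D x) := by
  induction x with
  | zero => simp
  | add x y hx hy => simp only [map_add, hx, hy]
  | tmul a b =>
    have hΔ : comul (R := C) (p b) =
        TensorProduct.map (p : B →ₗ[C] A) (p : B →ₗ[C] A) (comul (R := C) b) :=
      (CoalgHomClass.map_comp_comul_apply p b).symm
    rw [hequiv.apply_tmul hD, Algebra.TensorProduct.map_tmul, invariantDerivation_tmul, map_add,
      map_mul, ← rTensor_comp_section_map hs, ← hΔ]
    simp

end Extension

end PicardVessiot

end

open PicardVessiot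

theorem mainTheorem5 {C F A B : Type*}
    [Field C] [IsAlgClosed C] [Field F] [CharZero F] [Algebra C F]
    -- the differential field `F`, with field of constants `C`
    (DF : Derivation C F F) (hDF : ∀ a : F, DF a = 0 → a ∈ (algebraMap C F).range)
    -- the coordinate rings `A = C[G]` and `B = C[Ḡ]`
    [CommRing A] [HopfAlgebra C A] [CommRing B] [HopfAlgebra C B]
    [IsDomain (F ⊗[C] B)] [UniqueFactorizationMonoid (F ⊗[C] B)]
    (D : Derivation C (F ⊗[C] B) (F ⊗[C] B))
    (hD : PicardVessiot.ExtendsBase DF D)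
    (hequiv : PicardVessiot.IsEquivariant D)
    (hconst : PicardVessiot.NoNewConstants D)
    (hunit : PicardVessiot.DvdDerivImpliesUnit D)
    (p : B →ₐc[C] A) (i : A →ₐc[C] PicardVessiot.AdditiveGroupRing C)
    (hext : PicardVessiot.IsCentralExtension p i)
    (hvar : PicardVessiot.SplitsAsVarieties p)
    (hgrp : ¬ PicardVessiot.SplitsAsGroupsOver F p) :
    IsDomain (F ⊗[C] A) ∧ UniqueFactorizationMonoid (F ⊗[C] A) ∧
      ∃ D' : Derivation C (F ⊗[C] A) (F ⊗[C] A),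
        PicardVessiot.ExtendsAlong p D D' ∧
        PicardVessiot.IsEquivariant D' ∧
        PicardVessiot.NoNewConstants D' ∧
        PicardVessiot.DvdDerivImpliesUnit D' := by
  obtain ⟨s₀, hs₀⟩ := hvar
  obtain ⟨s, hs, hsε⟩ := exists_counit_section hs₀
  obtain ⟨e, f, he, hf⟩ := hext.exists_coordinate hs₀
  obtain ⟨e', heC, heX⟩ :=
    exists_polynomial_algEquiv_tensorProduct (F := F) e (p := (p : B →ₐ[C] A)) he
  have : CharZero C := (algebraMap C F).charZero
  have hdom : IsDomain (F ⊗[C] A) := e'.symm.toMulEquiv.isDomain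
  have hufm : UniqueFactorizationMonoid (F ⊗[C] A) :=
    e'.toMulEquiv.uniqueFactorizationMonoid inferInstance
  have hδ : IsTangent (tangentOf D ∘ₗ (s : A →ₗ[C] B)) :=
    (isTangent_tangentOf D).comp_section hsε
  set D' := invariantDerivation DF _ hδ with hD'
  set P : F ⊗[C] B →ₐ[C] F ⊗[C] A :=
    Algebra.TensorProduct.map (AlgHom.id C F) (p : B →ₐ[C] A) with hP
  have hDD' (x : F ⊗[C] B) : D' (P x) = P (D x) := invariantDerivation_map hequiv hD hs hδ x
  have hequiv' : IsEquivariant D' := isEquivariant_invariantDerivation DF hδ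
  set r : F ⊗[C] B := tangentOf D (s (e Polynomial.X)) ⊗ₜ 1 + (tangentOf D).rTensor B f
  have hY : D' (1 ⊗ₜ e Polynomial.X) = P r := by
    rw [hD', invariantDerivation_tmul, hf, map_add, map_add, rTensor_comp_section_map hs, ← hP,
      map_add, LinearMap.rTensor_tmul, LinearMap.rTensor_tmul, hδ.map_one]
    simp only [Derivation.map_one_eq_zero, TensorProduct.zero_tmul, zero_add, add_zero, hP,
      LinearMap.comp_apply, Algebra.TensorProduct.map_tmul, map_one]
    rw [← Algebra.TensorProduct.one_def, one_mul]
    rfl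
  have hconstB (x : F ⊗[C] B) (hx : D x = 0) : x ∈ (algebraMap C (F ⊗[C] B)).range :=
    hconst.mem_range hx
  have hr (x : F ⊗[C] B) : D x ≠ r := by
    rintro hx
    obtain ⟨t, ht⟩ := exists_bialgHom_section_of_constant hext.injective e he hf hconstB hequiv'
      hP hDD' (x := x) (by rw [map_sub, hY, hDD', hx, sub_self])
    exact hgrp (.of_bialgHom ht)
  set E := transportDerivation e' D' with hE
  have hEC (a : F ⊗[C] B) : E (Polynomial.C a) = Polynomial.C (D a) := by
    rw [hE, transportDerivation_apply, heC, hDD', AlgEquiv.symm_apply_eq, heC]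
  have hEX : E Polynomial.X = Polynomial.C r := by
    rw [hE, transportDerivation_apply, heX, hY, AlgEquiv.symm_apply_eq, heC]
  have hunit' : DvdDerivImpliesUnit D' := .of_transportDerivation (e := e')
    (dvdDerivImpliesUnit_polynomial hEC hEX hunit hconstB hr)
  refine ⟨hdom, hufm, D', hDD', hequiv', noNewConstants_of_forall_mem_range hunit' ?_, hunit'⟩
  intro x hx
  obtain ⟨c, hc⟩ := mem_range_of_derivation_polynomial_eq_zero hEC hEX hconstB hr
    (q := e'.symm x) (by rw [hE, transportDerivation_apply, e'.apply_symm_apply, hx, map_zero])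
  exact ⟨c, by rw [← e'.apply_symm_apply x, ← hc, e'.commutes]⟩
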